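/- \textbf{Setting.} Let $E\subset\mathbb R^d$ be a Borel set and $\mu$ a measure on $E$ with $\mu(E)<\infty$; all densities are with respect to $\mu$. Let $\Theta\subset\mathbb R^p$ and $\Lambda\subset\mathbb R^q$ be compact, and let $U\supset\Theta$, $V\supset\Lambda$ be open. Let $p^\star$ be a probability density on $E$, let $Z$ be a random vector in $\mathbb R^{d'}$, let $G_\theta:\mathbb R^{d'}\to E$ ($\theta\in\Theta$) be Borel functions such that $G_\theta(Z)$ has a density $p_\theta$, and let $\mathscr D=\{D_\alpha\}_{\alpha\in\Lambda}$ be a family of functions on $E$. Put $D^\star_\theta=p^\star/(p^\star+p_\theta)$, which is defined where $p^\star+p_\theta>0$. For probability measures $P,Q$ let $$D_{\rm JS}(P,Q)=\tfrac12 D_{\rm KL}\big(P\,\|\,\tfrac{P+Q}2\big)+\tfrac12 D_{\rm KL}\big(Q\,\|\,\tfrac{P+Q}2\big),$$ and write $D_{\rm JS}(p,q)$ when $P=p\,d\mu$, $Q=q\,d\mu$. Assume that there is $\theta^\star\in\Theta$ with $D_{\rm JS}(p^\star,p_{\theta^\star})\le D_{\rm JS}(p^\star,p_\theta)$ for all $\theta\in\Theta$.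 Let $X_1,\dots,X_n$ ($n\ge1$) be i.i.d. with density $p^\star$, let $Z_1,\dots,Z_n$ be i.i.d. with the law of $Z$, and let $\hat\theta$ be a random vector with values in $\Theta$ such that, almost surely, $$\sup_{\alpha\in\Lambda}\hat L(\hat\theta,\alpha)\le\sup_{\alpha\in\Lambda}\hat L(\theta,\alpha)\quad\text{for all }\theta\in\Theta,\qquad \hat L(\theta,\alpha)=\sum_{i=1}^n\ln D_\alpha(X_i)+\sum_{i=1}^n\ln\big(1-D_\alpha(G_\theta(Z_i))\big).$$ \textbf{Assumptions.} $(H_0)$ $t\in(0,1/2]$, and $\min(D^\star_\theta,1-D^\star_\theta)\ge t$ wherever $D^\star_\theta$ is defined, for all $\theta\in\Theta$. $(H_{\rm reg})$ With constants $\kappa\in(0,1/2)$ and $K$: (i) $\kappa\le D_\alpha\le1-\kappa$ on $E$ for all $\alpha\in\Lambda$; there is an open set $W\supset E$ such that $(x,\alpha)\mapsto D_\alpha(x)$ extends to a $C^1$ function on $W\times V$ with differential bounded by $K$; (ii) for all $z\in\mathbb R^{d'}$, $\theta\mapsto G_\theta(z)$ is bounded by $K$ on $\Theta$ and extends to a $C^1$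 map from $U$ to $W$ with differential bounded by $K$; (iii) for all $x\in E$, $\theta\mapsto p_\theta(x)$ is bounded by $K$ on $\Theta$ and extends to a $C^1$ function on $U$ with differential bounded by $K$. $(H'_\varepsilon)$ $\varepsilon\in(0,t)$, and for all $\theta\in\Theta$ there is $\alpha\in\Lambda$ such that $|D_\alpha-D^\star_\theta|\le\varepsilon$ wherever $D^\star_\theta$ is defined. \textbf{Theorem.} Under $(H_0)$, $(H_{\rm reg})$ and $(H'_\varepsilon)$, the random variable $D_{\rm JS}(p^\star,p_{\hat\theta})$ is integrable and $$0\le\mathbb E\,D_{\rm JS}(p^\star,p_{\hat\theta})-D_{\rm JS}(p^\star,p_{\theta^\star})\le c_1\varepsilon^2+\frac{c_2}{\sqrt n},$$ where $c_1>0$ depends only on $t$, and $c_2>0$ depends only on $t,p,q,\kappa,K,\Theta,U,\Lambda,V$ (in particular neither on $n$ nor on $\varepsilon$). Hence the difference is $O(\varepsilon^2+1/\sqrt n)$. -/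

import Mathlib

open MeasureTheory ProbabilityTheory
open scoped ENNReal

noncomputable section

/-- The Jensen-Shannon divergence
`(1/2) KL(P ‖ (P+Q)/2) + (1/2) KL(Q ‖ (P+Q)/2)` of two probability measures. It is at most `ln 2`,
so that passing to real numbers loses nothing. -/
def jsDiv {S : Type*} [MeasurableSpace S] (P Q : Measure S) : ℝ :=
  (1 / 2) * (InformationTheory.klDiv P ((2⁻¹ : ℝ≥0∞) • (P + Q))).toReal
    + (1 / 2) * (InformationTheory.klDiv Q ((2⁻¹ : ℝ≥0∞) • (P + Q))).toReal

/-- The data of the adversarial problem over a parameter set `Θ` of generators: a Borel set `E` of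
`ℝ^d`, a finite dominating measure `μ` on `E` (written as a measure on `ℝ^d` that does not charge
the complement of `E`), the unknown target density `pstar`, the law `ν` of the noise on `ℝ^{d'}`,
the generators `G θ : ℝ^{d'} → E`, with the densities `dens θ` of `G θ (Z)`, `Z ∼ ν`, and the
parametric discriminators `D α`.

The functions are total, but only their values at `θ ∈ Θ` and `x ∈ E` (or, for the
differentiability requirements below, near those sets) are constrained or used. -/
structure GANModel (d d' p q : ℕ) (Θ : Set (EuclideanSpace ℝ (Fin p))) where
  E : Set (EuclideanSpace ℝ (Fin d))
  measurableSet_E : MeasurableSet E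
  μ : Measure (EuclideanSpace ℝ (Fin d))
  μ_compl : μ Eᶜ = 0
  μ_finite : μ E < ∞
  pstar : EuclideanSpace ℝ (Fin d) → ℝ
  pstar_measurable : Measurable pstar
  pstar_nonneg : ∀ x ∈ E, 0 ≤ pstar x
  pstar_mass : ∫⁻ x, ENNReal.ofReal (pstar x) ∂μ = 1
  ν : Measure (EuclideanSpace ℝ (Fin d'))
  ν_prob : IsProbabilityMeasure ν
  G : EuclideanSpace ℝ (Fin p) → EuclideanSpace ℝ (Fin d') → EuclideanSpace ℝ (Fin d)
  G_measurable : ∀ θ ∈ Θ, Measurable (G θ)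
  G_mem : ∀ θ ∈ Θ, ∀ z, G θ z ∈ E
  dens : EuclideanSpace ℝ (Fin p) → EuclideanSpace ℝ (Fin d) → ℝ
  dens_measurable : ∀ θ ∈ Θ, Measurable (dens θ)
  dens_nonneg : ∀ θ ∈ Θ, ∀ x ∈ E, 0 ≤ dens θ x
  G_law : ∀ θ ∈ Θ, ν.map (G θ) = μ.withDensity (fun x => ENNReal.ofReal (dens θ x))
  D : EuclideanSpace ℝ (Fin q) → EuclideanSpace ℝ (Fin d) → ℝ

namespace GANModel

variable {d d' p q : ℕ} {Θ : Set (EuclideanSpace ℝ (Fin p))} (M : GANModel d d' p q Θ)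

/-- The target law `pstar dμ`. -/
def targetLaw : Measure (EuclideanSpace ℝ (Fin d)) :=
  M.μ.withDensity (fun x => ENNReal.ofReal (M.pstar x))

/-- The law `p_θ dμ` of the generated data. -/
def genLaw (θ : EuclideanSpace ℝ (Fin p)) : Measure (EuclideanSpace ℝ (Fin d)) :=
  M.μ.withDensity (fun x => ENNReal.ofReal (M.dens θ x))

/-- `D_JS(pstar, p_θ)`. -/
def js (θ : EuclideanSpace ℝ (Fin p)) : ℝ := jsDiv M.targetLaw (M.genLaw θ)

/-- The optimal discriminator `pstar / (pstar + p_θ)`. It is only looked at where the denominator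
is positive. -/
def optDisc (θ : EuclideanSpace ℝ (Fin p)) (x : EuclideanSpace ℝ (Fin d)) : ℝ :=
  M.pstar x / (M.pstar x + M.dens θ x)

/-- The optimal discriminators and their complements to one are bounded below by `t`. -/
def LowerBounded (t : ℝ) : Prop :=
  ∀ θ ∈ Θ, ∀ x ∈ M.E, 0 < M.pstar x + M.dens θ x →
    t ≤ min (M.optDisc θ x) (1 - M.optDisc θ x)

/-- The discriminators `D α`, `α ∈ Λ`, approximate every optimal discriminator up to `ε` in
supremum norm. -/
def Approximates (Λ : Set (EuclideanSpace ℝ (Fin q))) (ε : ℝ) : Prop :=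
  ∀ θ ∈ Θ, ∃ α ∈ Λ, ∀ x ∈ M.E, 0 < M.pstar x + M.dens θ x →
    |M.D α x - M.optDisc θ x| ≤ ε

/-- The regularity of the model. Since `Θ`, `Λ` and `E` need not be open, `C¹` means: `C¹` on open
neighbourhoods `U`, `V`, `W` of these sets. All the uniform bounds are at most `K`. -/
def Regular (U : Set (EuclideanSpace ℝ (Fin p))) (Λ V : Set (EuclideanSpace ℝ (Fin q)))
    (κ K : ℝ) : Prop :=
  -- values of the discriminators
  (∀ α ∈ Λ, ∀ x ∈ M.E, κ ≤ M.D α x ∧ M.D α x ≤ 1 - κ) ∧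
  -- smoothness of the discriminators, on a neighbourhood where the generators take their values
  (∃ W : Set (EuclideanSpace ℝ (Fin d)), IsOpen W ∧ M.E ⊆ W ∧
    (∀ θ ∈ U, ∀ z, M.G θ z ∈ W) ∧
    ContDiffOn ℝ 1 (fun y : EuclideanSpace ℝ (Fin d) × EuclideanSpace ℝ (Fin q) => M.D y.2 y.1)
      (W ×ˢ V) ∧
    ∀ y ∈ W ×ˢ V, ‖fderiv ℝ
      (fun y : EuclideanSpace ℝ (Fin d) × EuclideanSpace ℝ (Fin q) => M.D y.2 y.1) y‖ ≤ K) ∧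
  -- generators
  (∀ z, ContDiffOn ℝ 1 (fun θ => M.G θ z) U ∧ (∀ θ ∈ Θ, ‖M.G θ z‖ ≤ K) ∧
    ∀ θ ∈ U, ‖fderiv ℝ (fun θ => M.G θ z) θ‖ ≤ K) ∧
  -- densities
  (∀ x ∈ M.E, ContDiffOn ℝ 1 (fun θ => M.dens θ x) U ∧ (∀ θ ∈ Θ, |M.dens θ x| ≤ K) ∧
    ∀ θ ∈ U, ‖fderiv ℝ (fun θ => M.dens θ x) θ‖ ≤ K)

/-- The empirical criterion `∑ ln D_α(X_i) + ∑ ln (1 - D_α(G_θ(Z_i)))` at a given sample. -/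
def empCrit {n : ℕ} (x : Fin n → EuclideanSpace ℝ (Fin d)) (z : Fin n → EuclideanSpace ℝ (Fin d'))
    (θ : EuclideanSpace ℝ (Fin p)) (α : EuclideanSpace ℝ (Fin q)) : ℝ :=
  ∑ i, Real.log (M.D α (x i)) + ∑ i, Real.log (1 - M.D α (M.G θ (z i)))

/-- `θhat` minimizes `θ ↦ sup_{α ∈ Λ} empCrit θ α` over `Θ` at a given sample. -/
def IsGANMinimizer (Λ : Set (EuclideanSpace ℝ (Fin q))) {n : ℕ}
    (x : Fin n → EuclideanSpace ℝ (Fin d)) (z : Fin n → EuclideanSpace ℝ (Fin d'))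
    (θhat : EuclideanSpace ℝ (Fin p)) : Prop :=
  θhat ∈ Θ ∧ ∀ θ ∈ Θ, (⨆ α : Λ, M.empCrit x z θhat α) ≤ ⨆ α : Λ, M.empCrit x z θ α

/-- `θstar` minimizes `θ ↦ D_JS(pstar, p_θ)` over `Θ`. -/
def IsJSMinimizer (θstar : EuclideanSpace ℝ (Fin p)) : Prop :=
  θstar ∈ Θ ∧ ∀ θ ∈ Θ, M.js θstar ≤ M.js θ

end GANModel

end

/-!
Up to an affine normalization, `D_JS(pstar, p_θ)` is the value at the optimal discriminator of the
population criterion `c(θ, α) = ∫ ln D_α dP + ∫ ln (1 - D_α) dQ_θ`, where `P` is the target law and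
`Q_θ` the generated law (`IsBalancedSplit.jsDiv_eq`). Every discriminator does at most as well as
the optimal one (`IsBalancedSplit.criterion_le`), and one at uniform distance `ε` loses at most a
multiple of `ε ^ 2`, since the Kullback-Leibler divergence of two Bernoulli laws is bounded by their
`χ²` divergence (`IsBalancedSplit.le_criterion_add`). That bound needs `ε ≤ t / 2`; for larger `ε`
the term `4 ε ^ 2 / t ^ 2` exceeds `ln 2`, the largest value of the divergence. Comparing the
empirical criterion with `n c(θ, α)` at `θhat` and at `θstar` therefore bounds the excess risk of
`θhat` by `4 ε ^ 2 / t ^ 2` plus `1 / n` times the uniform deviation of the empirical criterion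
(`GANModel.js_sub_js_le`).

The expected uniform deviation is of order `√n`. The two halves of the criterion are treated
separately, so no independence between the data and the noise is needed. The functions
`ln D_α` and `ln (1 - D_α ∘ G_θ)` are bounded and Lipschitz in their parameters, with constants
obtained from the derivative bounds on the neighbourhoods of the compact parameter sets
(`IsCompact.exists_lipschitz_of_fderiv_le`). Chaining over dyadic nets of the parameter set
(`IsCompact.exists_hasDyadicNets`), with Hoeffding's lemma for the increments, gives the bound
without a logarithmic factor (`exists_envelope_of_lipschitz`). The exponential maximal inequality is
used pointwise, as an explicit integrable majorant, so that no supremum has to be measured.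

Measurability of `D_JS(pstar, p_θhat)` follows from the continuity of the criterion on `Θ`
(`GANModel.continuousOn_js`).
-/

/-! ### Maxima of finitely many centred empirical sums -/

/-- Hoeffding's lemma for a sum: the centred empirical sum of a function bounded by `b` over `n`
independent variables of law `P` is sub-Gaussian with variance proxy `n b²`. -/
theorem hasSubgaussianMGF_centredSum {S Ω : Type*} [MeasurableSpace S] [MeasurableSpace Ω]
    {Pr : Measure Ω} [IsProbabilityMeasure Pr] {P : Measure S} {n : ℕ} {X : Fin n → Ω → S}
    (hX : ∀ i, Measurable (X i)) (hlaw : ∀ i, Pr.map (X i) = P) (hind : iIndepFun X Pr)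
    {g : S → ℝ} (hg : Measurable g) {b : ℝ} (hb : ∀ x, |g x| ≤ b) :
    HasSubgaussianMGF (fun ω => ∑ i, g (X i ω) - n * ∫ x, g x ∂P) (n * (b ^ 2).toNNReal) Pr := by
  have key : ∀ i ∈ (Finset.univ : Finset (Fin n)),
      HasSubgaussianMGF (fun ω => g (X i ω) - ∫ x, g x ∂P) ((b ^ 2).toNNReal) Pr := by
    intro i _
    have h := hasSubgaussianMGF_of_mem_Icc (μ := Pr) (X := fun ω => g (X i ω)) (a := -b) (b := b)
      (hg.comp (hX i)).aemeasurable (ae_of_all _ fun ω => abs_le.mp (hb _))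
    have e : (‖b - -b‖₊ / 2) ^ 2 = (b ^ 2).toNNReal := by
      ext
      rw [Real.coe_toNNReal _ (sq_nonneg b)]
      push_cast
      rw [Real.norm_eq_abs, div_pow, sq_abs]
      ring
    rw [e] at h
    rw [← hlaw i, integral_map (hX i).aemeasurable hg.aestronglyMeasurable]
    exact h
  have h2 := HasSubgaussianMGF.sum_of_iIndepFun
    (hind.comp (fun _ x => g x - ∫ x, g x ∂P) (fun _ => hg.sub_const _)) key
  simpa [Finset.sum_sub_distrib] using h2

/-- The maximal inequality for finitely many centred empirical sums `y_j`, in the form of an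
integrable majorant: with `l = 1 / (δ √n)` it is
`l⁻¹ (log |J| + |J|⁻¹ ∑ j, (exp (l y_j) + exp (-l y_j)))`. In chaining `b / δ` stays constant while
`δ` is halved from one level to the next. -/
theorem exists_envelope_finset {S Ω ι : Type*} [MeasurableSpace S] [MeasurableSpace Ω]
    {Pr : Measure Ω} [IsProbabilityMeasure Pr] {P : Measure S} {n : ℕ} (hn : 0 < n)
    {X : Fin n → Ω → S} (hX : ∀ i, Measurable (X i)) (hlaw : ∀ i, Pr.map (X i) = P)
    (hind : iIndepFun X Pr) (J : Finset ι) {g : ι → S → ℝ} (hg : ∀ j ∈ J, Measurable (g j))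
    {b : ℝ} (hb : ∀ j ∈ J, ∀ x, |g j x| ≤ b) {δ : ℝ} (hδ : 0 < δ) :
    ∃ R : Ω → ℝ, Integrable R Pr ∧
      (∀ j ∈ J, ∀ ω, |∑ i, g j (X i ω) - n * ∫ x, g j x ∂P| ≤ R ω) ∧
      ∫ ω, R ω ∂Pr ≤ √n * (δ * (Real.log J.card + 2 * Real.exp (b ^ 2 / (2 * δ ^ 2)))) := by
  set Y : ι → Ω → ℝ := fun j ω => ∑ i, g j (X i ω) - n * ∫ x, g j x ∂P with hY
  have hsub : ∀ j ∈ J, HasSubgaussianMGF (Y j) (n * (b ^ 2).toNNReal) Pr := fun j hj =>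
    hasSubgaussianMGF_centredSum hX hlaw hind (hg j hj) (hb j hj)
  have hn' : (0 : ℝ) < n := by exact_mod_cast hn
  have hsn : 0 < √(n : ℝ) := Real.sqrt_pos.2 hn'
  -- With this exponent the sub-Gaussian bound `exp (n b² l² / 2)` no longer depends on `n`.
  set l : ℝ := (δ * √n)⁻¹ with hl
  have hlpos : 0 < l := by positivity
  set e : ℝ := Real.exp (b ^ 2 / (2 * δ ^ 2)) with he
  have hexp : ∀ s : ℝ, s ^ 2 = l ^ 2 →
      Real.exp (((n * (b ^ 2).toNNReal : NNReal) : ℝ) * s ^ 2 / 2) = e := by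
    intro s hs
    rw [hs, he, hl]
    congr 1
    rw [NNReal.coe_mul, Real.coe_toNNReal _ (sq_nonneg b), NNReal.coe_natCast, inv_pow, mul_pow,
      Real.sq_sqrt hn'.le]
    field_simp
  have hint : ∀ j ∈ J, ∀ s, Integrable (fun ω => Real.exp (s * Y j ω)) Pr := fun j hj s =>
    (hsub j hj).integrable_exp_mul s
  have hmgf : ∀ j ∈ J, ∀ s : ℝ, s ^ 2 = l ^ 2 → ∫ ω, Real.exp (s * Y j ω) ∂Pr ≤ e := by
    intro j hj s hs
    rw [← hexp s hs]
    exact (hsub j hj).mgf_le s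
  have hI : ∀ j ∈ J,
      Integrable (fun ω => Real.exp (l * Y j ω) + Real.exp (-l * Y j ω)) Pr := fun j hj =>
    (hint j hj l).add (hint j hj (-l))
  have hI2 : Integrable (fun ω => ∑ j ∈ J,
      (Real.exp (l * Y j ω) + Real.exp (-l * Y j ω))) Pr := integrable_finsetSum _ hI
  refine ⟨fun ω => (δ * √n) * (Real.log J.card + (J.card : ℝ)⁻¹ *
    ∑ j ∈ J, (Real.exp (l * Y j ω) + Real.exp (-l * Y j ω))), ?_, ?_, ?_⟩
  · exact ((integrable_const _).add (hI2.const_mul _)).const_mul _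
  · intro j hj ω
    have hc : (0 : ℝ) < J.card := by exact_mod_cast Finset.card_pos.2 ⟨j, hj⟩
    set T := ∑ j ∈ J, (Real.exp (l * Y j ω) + Real.exp (-l * Y j ω)) with hT
    have h1 : Real.exp (l * |Y j ω|) ≤ T := by
      have h2 : Real.exp (l * Y j ω) + Real.exp (-l * Y j ω) ≤ T :=
        Finset.single_le_sum (f := fun j => Real.exp (l * Y j ω) + Real.exp (-l * Y j ω))
          (fun _ _ => by positivity) hj
      refine le_trans ?_ h2
      rcases abs_choice (Y j ω) with h | h
      · rw [h]; linarith [Real.exp_pos (-l * Y j ω)]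
      · rw [h, mul_neg, ← neg_mul]; linarith [Real.exp_pos (l * Y j ω)]
    have hTpos : 0 < T := (Real.exp_pos _).trans_le h1
    -- `log T = log |J| + log (T / |J|)`, and `log u ≤ u` avoids an appeal to Jensen's inequality.
    have h3 : l * |Y j ω| ≤ Real.log J.card + (J.card : ℝ)⁻¹ * T := by
      have h4 : l * |Y j ω| ≤ Real.log T := (Real.le_log_iff_exp_le hTpos).2 h1
      have h5 : Real.log T = Real.log J.card + Real.log ((J.card : ℝ)⁻¹ * T) := by
        rw [← Real.log_mul hc.ne' (by positivity)]
        congr 1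
        field_simp
      have h6 := Real.log_le_sub_one_of_pos (x := (J.card : ℝ)⁻¹ * T) (by positivity)
      linarith
    calc |Y j ω| = (δ * √n) * (l * |Y j ω|) := by rw [hl]; field_simp
      _ ≤ _ := mul_le_mul_of_nonneg_left h3 (by positivity)
  · rw [integral_const_mul, integral_add (integrable_const _) (hI2.const_mul _),
      integral_const_mul, integral_finsetSum _ hI]
    simp only [integral_const, probReal_univ, smul_eq_mul, one_mul]
    have h7 : ∑ j ∈ J, ∫ ω, (Real.exp (l * Y j ω) + Real.exp (-l * Y j ω)) ∂Pr
        ≤ J.card * (2 * e) := by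
      rw [← nsmul_eq_mul]
      refine Finset.sum_le_card_nsmul _ _ _ fun j hj => ?_
      rw [integral_add (hint j hj l) (hint j hj (-l))]
      linarith [hmgf j hj l rfl, hmgf j hj (-l) (by ring)]
    have h8 : (J.card : ℝ)⁻¹ * (J.card * (2 * e)) ≤ 2 * e := by
      rw [← mul_assoc]
      have : (J.card : ℝ)⁻¹ * J.card ≤ 1 := inv_mul_le_one
      have he0 : 0 < e := Real.exp_pos _
      nlinarith
    have h9 := mul_le_mul_of_nonneg_left h7 (inv_nonneg.2 (Nat.cast_nonneg (α := ℝ) J.card))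
    calc δ * √n * (Real.log J.card + (J.card : ℝ)⁻¹ *
          ∑ j ∈ J, ∫ ω, (Real.exp (l * Y j ω) + Real.exp (-l * Y j ω)) ∂Pr)
        ≤ δ * √n * (Real.log J.card + 2 * e) := by
          refine mul_le_mul_of_nonneg_left ?_ (by positivity)
          linarith [h9.trans h8]
      _ = _ := by ring

/-! ### Nets of compact sets -/

/-- Covering the unit ball by finitely many balls of radius `1 / 2` and iterating by homogeneity
gives coverings at scale `2⁻ᵏ` of exponential cardinality. -/
theorem exists_cover_closedBall {F : Type*} [NormedAddCommGroup F] [NormedSpace ℝ F]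
    [FiniteDimensional ℝ F] :
    ∃ m : ℕ, ∀ (r : ℝ), 0 < r → ∀ k : ℕ, ∃ N : Finset F, N.card ≤ m ^ k ∧
      ∀ s : F, ‖s‖ ≤ r → ∃ u ∈ N, ‖s - u‖ ≤ r / 2 ^ k := by
  classical
  have hc : IsCompact (Metric.closedBall (0 : F) 1) := isCompact_closedBall _ _
  obtain ⟨A, -, hAf, hA⟩ := hc.finite_cover_balls (e := 1 / 2) (by norm_num)
  refine ⟨hAf.toFinset.card, fun r hr k => ?_⟩
  induction k with
  | zero => exact ⟨{0}, by simp, fun s hs => ⟨0, by simp, by simpa using hs⟩⟩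
  | succ k ih =>
    obtain ⟨N, hN, hcov⟩ := ih
    refine ⟨(N ×ˢ hAf.toFinset).image fun w => w.1 + (r / 2 ^ k) • w.2, ?_, fun s hs => ?_⟩
    · calc _ ≤ _ := Finset.card_image_le
        _ = N.card * hAf.toFinset.card := Finset.card_product _ _
        _ ≤ hAf.toFinset.card ^ k * hAf.toFinset.card :=
          Nat.mul_le_mul_right _ hN
        _ = _ := (pow_succ _ _).symm
    · obtain ⟨u, hu, hsu⟩ := hcov s hs
      set c : ℝ := r / 2 ^ k with hcdef
      have hc0 : 0 < c := by positivity
      have h1 : c⁻¹ • (s - u) ∈ Metric.closedBall (0 : F) 1 := by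
        rw [mem_closedBall_zero_iff, norm_smul, norm_inv, Real.norm_of_nonneg hc0.le,
          inv_mul_le_iff₀ hc0]
        linarith
      obtain ⟨a, ha, hsa⟩ := Set.mem_iUnion₂.1 (hA h1)
      refine ⟨u + c • a, Finset.mem_image.2 ⟨(u, a), by simp [hu, ha], rfl⟩, ?_⟩
      have h2 : s - (u + c • a) = c • (c⁻¹ • (s - u) - a) := by
        rw [smul_sub, smul_inv_smul₀ hc0.ne']; abel
      rw [h2, norm_smul, Real.norm_of_nonneg hc0.le]
      have h3 : ‖c⁻¹ • (s - u) - a‖ ≤ 1 / 2 := by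
        rw [← dist_eq_norm]; exact (Metric.mem_ball.1 hsa).le
      calc c * ‖c⁻¹ • (s - u) - a‖ ≤ c * (1 / 2) := by gcongr
        _ = r / 2 ^ (k + 1) := by rw [hcdef, pow_succ]; field_simp

/-- `T` has, at every scale `ρ 2⁻ᵏ`, a finite net of at most `mᵏ` of its points. -/
def HasDyadicNets {F : Type*} [NormedAddCommGroup F] (T : Set F) (ρ : ℝ) (m : ℕ) : Prop :=
  ∀ k : ℕ, ∃ N : Finset F, (N : Set F) ⊆ T ∧ N.card ≤ m ^ k ∧
    ∀ s ∈ T, ∃ u ∈ N, ‖s - u‖ ≤ ρ / 2 ^ k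

theorem IsCompact.exists_hasDyadicNets {F : Type*} [NormedAddCommGroup F] [NormedSpace ℝ F]
    [FiniteDimensional ℝ F] {T : Set F} (hT : IsCompact T) :
    ∃ ρ : ℝ, 0 < ρ ∧ ∃ m : ℕ, HasDyadicNets T ρ m := by
  classical
  obtain ⟨m, hcov⟩ := exists_cover_closedBall (F := F)
  obtain ⟨r, hr0, hr⟩ := hT.isBounded.exists_pos_norm_le
  refine ⟨2 * r, by positivity, m, fun k => ?_⟩
  obtain ⟨N, hN, hNc⟩ := hcov r hr0 k
  -- Each centre that is useful for `T` is moved to a point of `T`, which doubles the radius.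
  set N' := N.filter fun u => ∃ s ∈ T, ‖s - u‖ ≤ r / 2 ^ k with hN'
  have hsel : ∀ u : F, ∃ s : F, u ∈ N' → s ∈ T ∧ ‖s - u‖ ≤ r / 2 ^ k := by
    intro u
    by_cases h : u ∈ N'
    · obtain ⟨s, hs, hs'⟩ := (Finset.mem_filter.1 h).2
      exact ⟨s, fun _ => ⟨hs, hs'⟩⟩
    · exact ⟨0, fun h' => absurd h' h⟩
  choose c hc using hsel
  refine ⟨N'.image c, ?_, ?_, ?_⟩
  · intro v hv
    obtain ⟨u, hu, rfl⟩ := Finset.mem_image.1 (Finset.mem_coe.1 hv)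
    exact (hc u hu).1
  · exact Finset.card_image_le.trans ((Finset.card_filter_le _ _).trans hN)
  · intro s hs
    obtain ⟨u, hu, hsu⟩ := hNc s (hr s hs)
    have hu' : u ∈ N' := Finset.mem_filter.2 ⟨hu, s, hs, hsu⟩
    refine ⟨c u, Finset.mem_image_of_mem _ hu', ?_⟩
    calc ‖s - c u‖ = ‖(s - u) - (c u - u)‖ := by congr 1; abel
      _ ≤ ‖s - u‖ + ‖c u - u‖ := norm_sub_le _ _
      _ ≤ r / 2 ^ k + r / 2 ^ k := add_le_add hsu (hc u hu').2
      _ = _ := by ring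

/-! ### Chaining -/

/-- The constant of the chaining bound, for functions bounded by `B` and `A`-Lipschitz in a
parameter that ranges over a set with dyadic nets of parameters `ρ`, `m`. -/
noncomputable def chainConst (A B ρ : ℝ) (m : ℕ) : ℝ :=
  2 * Real.exp (B ^ 2 / 2) + 6 * Real.log m + 4 * Real.exp (2 * (A * ρ) ^ 2) + 2 * A * ρ

theorem chainConst_pos {A B ρ : ℝ} {m : ℕ} (hA : 0 ≤ A) (hρ : 0 < ρ) : 0 < chainConst A B ρ m := by
  have := Real.log_natCast_nonneg m
  unfold chainConst
  positivity

theorem sum_range_odd_div_two_pow_le (l : ℝ) (hl : 0 ≤ l) (c : ℝ) (hc : 0 ≤ c) (n : ℕ) :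
    ∑ k ∈ Finset.range n, (1 / 2 ^ k : ℝ) * ((2 * k + 1) * l + 2 * c) ≤ 6 * l + 4 * c := by
  have h : ∑ k ∈ Finset.range n, (1 / 2 ^ k : ℝ) * ((2 * k + 1) * l + 2 * c)
      = 6 * l + 4 * c - ((4 * n + 6) * l + 4 * c) / 2 ^ n := by
    induction n with
    | zero => simp
    | succ n ih =>
      rw [Finset.sum_range_succ, ih]
      push_cast
      field_simp
      ring
  rw [h]
  have : 0 ≤ ((4 * n + 6) * l + 4 * c) / (2 : ℝ) ^ n := by positivity
  linarith

/-- The uniform deviation of the empirical sums of a parametric Lipschitz family of bounded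
functions is of order `√n` in expectation, without a logarithmic factor. The supremum over the
family enters through an integrable majorant, so that its measurability is not an issue. -/
theorem exists_envelope_of_lipschitz {F S Ω : Type*} [NormedAddCommGroup F]
    [MeasurableSpace S] [MeasurableSpace Ω]
    {Pr : Measure Ω} [IsProbabilityMeasure Pr] {P : Measure S} [IsProbabilityMeasure P]
    {n : ℕ} (hn : 0 < n)
    {X : Fin n → Ω → S} (hX : ∀ i, Measurable (X i)) (hlaw : ∀ i, Pr.map (X i) = P)
    (hind : iIndepFun X Pr) {T : Set F} {ρ : ℝ} (hρ : 0 < ρ) {m : ℕ}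
    (hT : HasDyadicNets T ρ m)
    {f : F → S → ℝ} (hf : ∀ s ∈ T, Measurable (f s)) {A B : ℝ} (hA : 0 ≤ A)
    (hB : ∀ s ∈ T, ∀ x, |f s x| ≤ B)
    (hL : ∀ s ∈ T, ∀ s' ∈ T, ∀ x, |f s x - f s' x| ≤ A * ‖s - s'‖) :
    ∃ R : Ω → ℝ, Integrable R Pr ∧
      (∀ s ∈ T, ∀ ω, |∑ i, f s (X i ω) - n * ∫ x, f s x ∂P| ≤ R ω) ∧
      ∫ ω, R ω ∂Pr ≤ √n * chainConst A B ρ m := by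
  classical
  choose N hNT hNc hN using hT
  have hfint : ∀ s ∈ T, Integrable (f s) P := fun s hs =>
    Integrable.of_bound (hf s hs).aestronglyMeasurable B (ae_of_all _ fun x => hB s hs x)
  set Y : F → Ω → ℝ := fun s ω => ∑ i, f s (X i ω) - n * ∫ x, f s x ∂P with hY
  have hYsub : ∀ s ∈ T, ∀ s' ∈ T, ∀ ω, Y s ω - Y s' ω
      = ∑ i, (f s (X i ω) - f s' (X i ω)) - n * ∫ x, (f s x - f s' x) ∂P := by
    intro s hs s' hs' ω
    rw [integral_sub (hfint s hs) (hfint s' hs'), Finset.sum_sub_distrib]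
    simp only [hY]
    ring
  have hlog : 0 ≤ Real.log m := Real.log_natCast_nonneg m
  -- the coarsest net
  obtain ⟨R0, hR0i, hR0, hR0b⟩ := exists_envelope_finset hn hX hlaw hind (N 0)
    (fun s hs => hf s (hNT 0 hs)) (fun s hs => hB s (hNT 0 hs)) one_pos
  -- the links between consecutive nets
  set J : ℕ → Finset (F × F) := fun k =>
    (N k ×ˢ N (k + 1)).filter fun w => ‖w.1 - w.2‖ ≤ 2 * ρ / 2 ^ k with hJ
  have hJmem : ∀ k, ∀ w ∈ J k, w.1 ∈ T ∧ w.2 ∈ T ∧ ‖w.1 - w.2‖ ≤ 2 * ρ / 2 ^ k := by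
    intro k w hw
    obtain ⟨h1, h2⟩ := Finset.mem_filter.1 hw
    obtain ⟨h3, h4⟩ := Finset.mem_product.1 h1
    exact ⟨hNT k h3, hNT _ h4, h2⟩
  have hJlog : ∀ k, Real.log (J k).card ≤ (2 * k + 1) * Real.log m := by
    intro k
    have hc : (J k).card ≤ m ^ (2 * k + 1) := by
      calc (J k).card ≤ (N k ×ˢ N (k + 1)).card := Finset.card_filter_le _ _
        _ = (N k).card * (N (k + 1)).card := Finset.card_product _ _
        _ ≤ m ^ k * m ^ (k + 1) := Nat.mul_le_mul (hNc _) (hNc _)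
        _ = m ^ (2 * k + 1) := by rw [← pow_add]; congr 1; ring
    rcases Nat.eq_zero_or_pos (J k).card with h0 | h0
    · rw [h0]; simp only [Nat.cast_zero, Real.log_zero]; positivity
    · calc Real.log (J k).card ≤ Real.log ((m : ℝ) ^ (2 * k + 1)) :=
            Real.log_le_log (by exact_mod_cast h0) (by exact_mod_cast hc)
        _ = _ := by rw [Real.log_pow]; push_cast; ring
  have hlink : ∀ k : ℕ, ∃ R : Ω → ℝ, Integrable R Pr ∧
      (∀ w ∈ J k, ∀ ω, |Y w.1 ω - Y w.2 ω| ≤ R ω) ∧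
      ∫ ω, R ω ∂Pr ≤ √n * ((1 / 2 ^ k : ℝ) * ((2 * k + 1) * Real.log m +
        2 * Real.exp (2 * (A * ρ) ^ 2))) := by
    intro k
    obtain ⟨R, hRi, hR, hRb⟩ := exists_envelope_finset hn hX hlaw hind (J k)
      (g := fun w x => f w.1 x - f w.2 x) (b := A * (2 * ρ / 2 ^ k)) (δ := 1 / 2 ^ k)
      (fun w hw => (hf _ (hJmem k w hw).1).sub (hf _ (hJmem k w hw).2.1))
      (fun w hw x => (hL _ (hJmem k w hw).1 _ (hJmem k w hw).2.1 x).trans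
        (mul_le_mul_of_nonneg_left (hJmem k w hw).2.2 hA)) (by positivity)
    refine ⟨R, hRi, fun w hw ω => ?_, hRb.trans ?_⟩
    · rw [hYsub _ (hJmem k w hw).1 _ (hJmem k w hw).2.1]
      exact hR w hw ω
    · have e : (A * (2 * ρ / 2 ^ k)) ^ 2 / (2 * (1 / 2 ^ k : ℝ) ^ 2) = 2 * (A * ρ) ^ 2 := by
        field_simp
      rw [e]
      gcongr
      exact hJlog k
  choose R hRi hR hRb using hlink
  refine ⟨fun ω => R0 ω + ∑ k ∈ Finset.range n, R k ω + 2 * A * ρ, ?_, ?_, ?_⟩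
  · exact (hR0i.add (integrable_finsetSum _ fun k _ => hRi k)).add (integrable_const _)
  · intro s hs ω
    choose u hu hsu using fun k => hN k s hs
    have huT : ∀ k, u k ∈ T := fun k => hNT k (hu k)
    have hw : ∀ k, (u k, u (k + 1)) ∈ J k := by
      intro k
      refine Finset.mem_filter.2 ⟨Finset.mem_product.2 ⟨hu k, hu (k + 1)⟩, ?_⟩
      calc ‖u k - u (k + 1)‖ = ‖(s - u (k + 1)) - (s - u k)‖ := by congr 1; abel
        _ ≤ ‖s - u (k + 1)‖ + ‖s - u k‖ := norm_sub_le _ _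
        _ ≤ ρ / 2 ^ (k + 1) + ρ / 2 ^ k := add_le_add (hsu _) (hsu _)
        _ ≤ ρ / 2 ^ k + ρ / 2 ^ k := by
          gcongr
          · norm_num
          · omega
        _ = _ := by ring
    have hsum : ∀ j : ℕ, |Y (u j) ω| ≤ R0 ω + ∑ k ∈ Finset.range j, R k ω := by
      intro j
      induction j with
      | zero => simpa using hR0 _ (hu 0) ω
      | succ j ih =>
        rw [Finset.sum_range_succ]
        have h1 := hR j _ (hw j) ω
        have h2 : |Y (u (j + 1)) ω| ≤ |Y (u j) ω| + |Y (u j) ω - Y (u (j + 1)) ω| := by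
          have := abs_sub (Y (u j) ω) (Y (u j) ω - Y (u (j + 1)) ω)
          rwa [sub_sub_cancel] at this
        simp only at h1
        linarith
    -- The chain stops at level `n`, where the Lipschitz bound alone controls the remainder.
    have hres : |Y s ω - Y (u n) ω| ≤ 2 * A * ρ := by
      have hd : ∀ x, |f s x - f (u n) x| ≤ A * ρ / 2 ^ n := fun x =>
        (hL s hs _ (huT n) x).trans (by
          rw [mul_div_assoc]
          exact mul_le_mul_of_nonneg_left (hsu n) hA)
      rw [hYsub s hs _ (huT n)]
      have h1 : |∑ i, (f s (X i ω) - f (u n) (X i ω))| ≤ n * (A * ρ / 2 ^ n) := by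
        refine (Finset.abs_sum_le_sum_abs _ _).trans ?_
        refine (Finset.sum_le_card_nsmul _ _ _ fun i _ => hd (X i ω)).trans ?_
        simp
      have h2 : |∫ x, (f s x - f (u n) x) ∂P| ≤ A * ρ / 2 ^ n := by
        have := norm_integral_le_of_norm_le_const (μ := P)
          (f := fun x => f s x - f (u n) x) (ae_of_all _ hd)
        simpa using this
      have h3 : |(n : ℝ) * ∫ x, (f s x - f (u n) x) ∂P| ≤ n * (A * ρ / 2 ^ n) := by
        rw [abs_mul, Nat.abs_cast]
        gcongr
      have h4 : (n : ℝ) * (A * ρ / 2 ^ n) ≤ A * ρ := by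
        have h5 : (n : ℝ) ≤ 2 ^ n := by exact_mod_cast (Nat.lt_two_pow_self).le
        rw [← mul_div_assoc, div_le_iff₀ (by positivity), mul_comm]
        gcongr
      linarith [abs_sub (∑ i, (f s (X i ω) - f (u n) (X i ω)))
        (n * ∫ x, (f s x - f (u n) x) ∂P)]
    have h6 : |Y s ω| ≤ |Y (u n) ω| + |Y s ω - Y (u n) ω| := by
      have := abs_add_le (Y (u n) ω) (Y s ω - Y (u n) ω)
      rwa [add_sub_cancel] at this
    linarith [hsum n]
  · have hsi : Integrable (fun ω => ∑ k ∈ Finset.range n, R k ω) Pr :=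
      integrable_finsetSum _ fun k _ => hRi k
    have hsi0 : Integrable (fun ω => R0 ω + ∑ k ∈ Finset.range n, R k ω) Pr := hR0i.add hsi
    rw [integral_add hsi0 (integrable_const _), integral_add hR0i hsi,
      integral_finsetSum _ fun k _ => hRi k]
    simp only [integral_const, probReal_univ, smul_eq_mul, one_mul]
    have hs1 : (1 : ℝ) ≤ √n := by
      rw [Real.one_le_sqrt]; exact_mod_cast hn
    have h0 : Real.log (N 0).card ≤ 0 :=
      Real.log_nonpos (Nat.cast_nonneg _) (by exact_mod_cast (hNc 0).trans_eq (pow_zero m))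
    have hR0b' : ∫ ω, R0 ω ∂Pr ≤ √n * (2 * Real.exp (B ^ 2 / 2)) := by
      refine hR0b.trans ?_
      rw [one_mul, one_pow, mul_one]
      refine mul_le_mul_of_nonneg_left ?_ (Real.sqrt_nonneg _)
      linarith
    have hsumb : ∑ k ∈ Finset.range n, ∫ ω, R k ω ∂Pr
        ≤ √n * (6 * Real.log m + 4 * Real.exp (2 * (A * ρ) ^ 2)) := by
      refine (Finset.sum_le_sum fun k _ => hRb k).trans ?_
      rw [← Finset.mul_sum]
      gcongr
      exact sum_range_odd_div_two_pow_le _ hlog _ (Real.exp_pos _).le n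
    have hlast : 2 * A * ρ ≤ √n * (2 * A * ρ) := le_mul_of_one_le_left (by positivity) hs1
    rw [chainConst]
    linarith

/-! ### Lipschitz bounds on compact sets from derivative bounds on a neighbourhood -/

/-- Near the diagonal the segment between two points of `T` stays in `O` and the mean value
inequality applies; away from the diagonal the oscillation bound suffices. The radius `r` does not
depend on the function. -/
theorem IsCompact.exists_lipschitz_of_fderiv_le {F : Type*} [NormedAddCommGroup F]
    [NormedSpace ℝ F] {T O : Set F} (hT : IsCompact T) (hO : IsOpen O) (hTO : T ⊆ O) :
    ∃ r : ℝ, 0 < r ∧ ∀ (h : F → ℝ) (A : ℝ), (∀ y ∈ O, DifferentiableAt ℝ h y) →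
      (∀ y ∈ O, ‖fderiv ℝ h y‖ ≤ A) → (∀ s ∈ T, ∀ s' ∈ T, |h s - h s'| ≤ 1) →
      ∀ s ∈ T, ∀ s' ∈ T, |h s - h s'| ≤ max A r⁻¹ * ‖s - s'‖ := by
  obtain ⟨r, hr, hsub⟩ := hT.exists_thickening_subset_open hO hTO
  refine ⟨r, hr, fun h A hd hA h1 s hs s' hs' => ?_⟩
  rcases lt_or_ge ‖s - s'‖ r with hlt | hge
  · have hball : Metric.ball s' r ⊆ O := fun y hy =>
      hsub (Metric.mem_thickening_iff.2 ⟨s', hs', Metric.mem_ball.1 hy⟩)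
    have := (convex_ball s' r).norm_image_sub_le_of_norm_fderiv_le (𝕜 := ℝ) (f := h) (C := A)
      (fun y hy => hd y (hball hy)) (fun y hy => hA y (hball hy)) (Metric.mem_ball_self hr)
      (by rwa [Metric.mem_ball, dist_eq_norm] : s ∈ Metric.ball s' r)
    rw [← Real.norm_eq_abs]
    exact this.trans (mul_le_mul_of_nonneg_right (le_max_left _ _) (norm_nonneg _))
  · refine (h1 s hs s' hs').trans ?_
    calc (1 : ℝ) = r⁻¹ * r := (inv_mul_cancel₀ hr.ne').symm
      _ ≤ max A r⁻¹ * ‖s - s'‖ := by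
        gcongr
        · exact le_max_right _ _

theorem Real.abs_log_sub_log_le {κ a b : ℝ} (hκ : 0 < κ) (ha : κ ≤ a) (hb : κ ≤ b) :
    |Real.log a - Real.log b| ≤ κ⁻¹ * |a - b| := by
  have key : ∀ {a b : ℝ}, κ ≤ a → κ ≤ b → Real.log a - Real.log b ≤ κ⁻¹ * |a - b| := by
    intro a b ha hb
    have ha0 := hκ.trans_le ha
    have hb0 := hκ.trans_le hb
    rw [← Real.log_div ha0.ne' hb0.ne']
    calc Real.log (a / b) ≤ a / b - 1 := Real.log_le_sub_one_of_pos (by positivity)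
      _ = b⁻¹ * (a - b) := by field_simp
      _ ≤ b⁻¹ * |a - b| := by gcongr; exact le_abs_self _
      _ ≤ κ⁻¹ * |a - b| := by gcongr
  rw [abs_le]
  constructor
  · have := key hb ha
    rw [abs_sub_comm] at this
    linarith
  · exact key ha hb

theorem Real.abs_log_le_of_mem_Icc {κ a : ℝ} (hκ : 0 < κ) (ha : κ ≤ a) (ha1 : a ≤ 1) :
    |Real.log a| ≤ -Real.log κ := by
  rw [abs_of_nonpos (Real.log_nonpos (hκ.le.trans ha) ha1)]
  exact neg_le_neg (Real.log_le_log hκ ha)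

/-! ### Binary entropy -/

theorem mul_log_add_le_mul_log_self {a b : ℝ} (ha : 0 < a) (ha1 : a < 1) (hb : 0 < b)
    (hb1 : b < 1) :
    a * Real.log b + (1 - a) * Real.log (1 - b)
      ≤ a * Real.log a + (1 - a) * Real.log (1 - a) := by
  have h1 := Real.log_le_sub_one_of_pos (div_pos hb ha)
  have h2 := Real.log_le_sub_one_of_pos (div_pos (sub_pos.2 hb1) (sub_pos.2 ha1))
  rw [Real.log_div hb.ne' ha.ne'] at h1
  rw [Real.log_div (sub_pos.2 hb1).ne' (sub_pos.2 ha1).ne'] at h2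
  have h3 := mul_le_mul_of_nonneg_left h1 ha.le
  have h4 := mul_le_mul_of_nonneg_left h2 (sub_pos.2 ha1).le
  have h5 : a * (b / a - 1) = b - a := by field_simp
  have h6 : (1 - a) * ((1 - b) / (1 - a) - 1) = a - b := by
    have := (sub_pos.2 ha1).ne'
    field_simp
    ring
  linarith

/-- The Kullback-Leibler divergence between Bernoulli laws is at most the `χ²` divergence, which is
quadratic in the difference of the parameters. -/
theorem mul_log_self_le_mul_log_add {a b c ε : ℝ} (ha : 0 < a) (ha1 : a < 1) (hc : 0 < c)
    (hb : c ≤ b) (hb1 : b ≤ 1 - c) (hab : |b - a| ≤ ε) :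
    a * Real.log a + (1 - a) * Real.log (1 - a)
      ≤ a * Real.log b + (1 - a) * Real.log (1 - b) + ε ^ 2 / c ^ 2 := by
  have hb0 : 0 < b := hc.trans_le hb
  have hb0' : 0 < 1 - b := by linarith
  have h1 := Real.log_le_sub_one_of_pos (div_pos ha hb0)
  have h2 := Real.log_le_sub_one_of_pos (div_pos (sub_pos.2 ha1) hb0')
  rw [Real.log_div ha.ne' hb0.ne'] at h1
  rw [Real.log_div (sub_pos.2 ha1).ne' hb0'.ne'] at h2
  have h3 := mul_le_mul_of_nonneg_left h1 ha.le
  have h4 := mul_le_mul_of_nonneg_left h2 (sub_pos.2 ha1).le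
  have h5 : a * (a / b - 1) + (1 - a) * ((1 - a) / (1 - b) - 1) = (b - a) ^ 2 / (b * (1 - b)) := by
    field_simp
    ring
  have h6 : (b - a) ^ 2 / (b * (1 - b)) ≤ ε ^ 2 / c ^ 2 := by
    have h7 : (b - a) ^ 2 ≤ ε ^ 2 := by
      rw [← sq_abs (b - a)]
      gcongr
    have h8 : c ^ 2 ≤ b * (1 - b) := by
      rw [sq]
      exact mul_le_mul hb (by linarith) hc.le hb0.le
    exact div_le_div₀ (sq_nonneg _) h7 (by positivity) h8
  linarith

/-! ### The Jensen-Shannon divergence of two comparable laws -/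

/-- `P` and `Q` are probability measures with densities `a` and `1 - a` with respect to `σ`
(which is then `P + Q`), and these densities are at least `t`. -/
structure IsBalancedSplit {S : Type*} [MeasurableSpace S] (P Q σ : Measure S) (a : S → ℝ)
    (t : ℝ) : Prop where
  prob_left : IsProbabilityMeasure P
  prob_right : IsProbabilityMeasure Q
  measurable : Measurable a
  pos : 0 < t
  mem_Icc : ∀ᵐ x ∂σ, t ≤ a x ∧ a x ≤ 1 - t
  left_eq : P = σ.withDensity fun x => ENNReal.ofReal (a x)
  right_eq : Q = σ.withDensity fun x => ENNReal.ofReal (1 - a x)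

theorem integral_withDensity_ofReal {S : Type*} [MeasurableSpace S] {σ : Measure S} {b : S → ℝ}
    (hb : Measurable b) (hb0 : ∀ᵐ x ∂σ, 0 ≤ b x) (h : S → ℝ) :
    ∫ x, h x ∂(σ.withDensity fun x => ENNReal.ofReal (b x)) = ∫ x, b x * h x ∂σ := by
  rw [integral_withDensity_eq_integral_toReal_smul hb.ennreal_ofReal
    (ae_of_all _ fun _ => ENNReal.ofReal_lt_top)]
  refine integral_congr_ae (hb0.mono fun x hx => ?_)
  simp [ENNReal.toReal_ofReal hx]

/-- The density of `P` with respect to `σ / 2` is `2 b`, which gives the term `ln 2`. -/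
theorem toReal_klDiv_half_smul {S : Type*} [MeasurableSpace S] {P σ : Measure S}
    [IsProbabilityMeasure P] (hσ : σ Set.univ = 2) {b : S → ℝ} (hb : Measurable b) {t : ℝ}
    (ht : 0 < t) (hbt : ∀ᵐ x ∂σ, t ≤ b x ∧ b x ≤ 1)
    (hP : P = σ.withDensity fun x => ENNReal.ofReal (b x)) :
    (InformationTheory.klDiv P ((2⁻¹ : ℝ≥0∞) • σ)).toReal
      = Real.log 2 + ∫ x, b x * Real.log (b x) ∂σ := by
  have hσf : IsFiniteMeasure σ := ⟨by rw [hσ]; exact ENNReal.ofNat_lt_top⟩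
  set m := (2⁻¹ : ℝ≥0∞) • σ with hm
  have hmf : IsFiniteMeasure m := ⟨by
    rw [hm, Measure.smul_apply, hσ, smul_eq_mul, ENNReal.inv_mul_cancel (by simp) (by simp)]
    exact ENNReal.one_lt_top⟩
  have hσm : σ = (2 : ℝ≥0∞) • m := by
    rw [hm, smul_smul, ENNReal.mul_inv_cancel (by simp) (by simp), one_smul]
  have hPm : P = m.withDensity fun x => ENNReal.ofReal (2 * b x) := by
    rw [hP]
    conv_lhs => rw [hσm]
    rw [withDensity_smul_measure, ← withDensity_smul _ hb.ennreal_ofReal]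
    congr 1
    ext x
    rw [Pi.smul_apply, smul_eq_mul, ENNReal.ofReal_mul (by norm_num)]
    simp
  have hPσ : P ≪ σ := hP ▸ withDensity_absolutelyContinuous _ _
  have hPac : P ≪ m := hPm ▸ withDensity_absolutelyContinuous _ _
  have hrn : P.rnDeriv m =ᵐ[m] fun x => ENNReal.ofReal (2 * b x) := by
    conv_lhs => rw [hPm]
    exact Measure.rnDeriv_withDensity m (by fun_prop)
  have hbtP : ∀ᵐ x ∂P, t ≤ b x ∧ b x ≤ 1 := hPσ.ae_le hbt
  have hllr : llr P m =ᵐ[P] fun x => Real.log 2 + Real.log (b x) := by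
    filter_upwards [hPac.ae_le hrn, hbtP] with x hx hx'
    have hb0 := ht.trans_le hx'.1
    rw [llr, hx, ENNReal.toReal_ofReal (by positivity), Real.log_mul (by norm_num) hb0.ne']
  have hint : Integrable (fun x => Real.log (b x)) P :=
    Integrable.of_bound hb.log.aestronglyMeasurable (-Real.log t)
      (hbtP.mono fun x hx => Real.abs_log_le_of_mem_Icc ht hx.1 hx.2)
  rw [InformationTheory.toReal_klDiv_of_measure_eq hPac (by
      rw [measure_univ, hm, Measure.smul_apply, hσ, smul_eq_mul,
        ENNReal.inv_mul_cancel (by simp) (by simp)]),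
    integral_congr_ae hllr, integral_add (integrable_const _) hint]
  congr 1
  · simp
  · conv_lhs => rw [hP]
    exact integral_withDensity_ofReal hb (hbt.mono fun x hx => ht.le.trans hx.1) _

namespace IsBalancedSplit

variable {S : Type*} [MeasurableSpace S] {P Q σ : Measure S} {a : S → ℝ} {t : ℝ}

theorem add_eq (h : IsBalancedSplit P Q σ a t) : P + Q = σ := by
  rw [h.left_eq, h.right_eq, ← withDensity_add_left h.measurable.ennreal_ofReal]
  conv_rhs => rw [← withDensity_one (μ := σ)]
  refine withDensity_congr_ae (h.mem_Icc.mono fun x hx => ?_)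
  have := h.pos
  rw [Pi.add_apply, ← ENNReal.ofReal_add (by linarith) (by linarith)]
  simp

theorem measure_univ_eq (h : IsBalancedSplit P Q σ a t) : σ Set.univ = 2 := by
  have := h.prob_left
  have := h.prob_right
  rw [← h.add_eq, Measure.add_apply, measure_univ, measure_univ, one_add_one_eq_two]

theorem isFiniteMeasure (h : IsBalancedSplit P Q σ a t) : IsFiniteMeasure σ :=
  ⟨by rw [h.measure_univ_eq]; exact ENNReal.ofNat_lt_top⟩

theorem integral_left_add_integral_right (h : IsBalancedSplit P Q σ a t) {f g : S → ℝ}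
    (hf : Measurable f) (hg : Measurable g) {B : ℝ} (hfB : ∀ᵐ x ∂σ, |f x| ≤ B)
    (hgB : ∀ᵐ x ∂σ, |g x| ≤ B) :
    Integrable (fun x => a x * f x + (1 - a x) * g x) σ ∧
    ∫ x, f x ∂P + ∫ x, g x ∂Q = ∫ x, (a x * f x + (1 - a x) * g x) ∂σ := by
  have := h.isFiniteMeasure
  have ht := h.pos
  have i1 : Integrable (fun x => a x * f x) σ := by
    refine Integrable.of_bound (h.measurable.mul hf).aestronglyMeasurable (1 * B) ?_
    filter_upwards [h.mem_Icc, hfB] with x hx hx'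
    rw [Real.norm_eq_abs, abs_mul]
    exact mul_le_mul (by rw [abs_le]; constructor <;> linarith) hx' (abs_nonneg _) zero_le_one
  have i2 : Integrable (fun x => (1 - a x) * g x) σ := by
    refine Integrable.of_bound ((h.measurable.const_sub 1).mul hg).aestronglyMeasurable (1 * B) ?_
    filter_upwards [h.mem_Icc, hgB] with x hx hx'
    rw [Real.norm_eq_abs, abs_mul]
    exact mul_le_mul (by rw [abs_le]; constructor <;> linarith) hx' (abs_nonneg _) zero_le_one
  refine ⟨i1.add i2, ?_⟩
  rw [integral_add i1 i2, h.left_eq, h.right_eq,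
    integral_withDensity_ofReal h.measurable (h.mem_Icc.mono fun x hx => by linarith),
    integral_withDensity_ofReal (h.measurable.const_sub 1)
      (h.mem_Icc.mono fun x hx => by linarith)]

theorem ae_abs_log_le (h : IsBalancedSplit P Q σ a t) :
    (∀ᵐ x ∂σ, |Real.log (a x)| ≤ -Real.log t) ∧ ∀ᵐ x ∂σ, |Real.log (1 - a x)| ≤ -Real.log t := by
  have ht := h.pos
  exact ⟨h.mem_Icc.mono fun x hx => Real.abs_log_le_of_mem_Icc ht hx.1 (by linarith),
    h.mem_Icc.mono fun x hx => Real.abs_log_le_of_mem_Icc ht (by linarith) (by linarith)⟩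

theorem integrable_entropy (h : IsBalancedSplit P Q σ a t) :
    Integrable (fun x => a x * Real.log (a x) + (1 - a x) * Real.log (1 - a x)) σ :=
  (h.integral_left_add_integral_right h.measurable.log (h.measurable.const_sub 1).log
    h.ae_abs_log_le.1 h.ae_abs_log_le.2).1

/-- Up to affine normalization the Jensen-Shannon divergence is the value of the discrimination
criterion at the optimal discriminator `a`. -/
theorem jsDiv_eq (h : IsBalancedSplit P Q σ a t) :
    2 * jsDiv P Q - 2 * Real.log 2
      = ∫ x, (a x * Real.log (a x) + (1 - a x) * Real.log (1 - a x)) ∂σ := by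
  have := h.prob_left
  have := h.prob_right
  have := h.isFiniteMeasure
  have ht := h.pos
  have hm := h.measurable.const_sub 1
  rw [← (h.integral_left_add_integral_right h.measurable.log hm.log
    h.ae_abs_log_le.1 h.ae_abs_log_le.2).2, jsDiv, h.add_eq,
    toReal_klDiv_half_smul h.measure_univ_eq h.measurable ht
      (h.mem_Icc.mono fun x hx => ⟨hx.1, by linarith⟩) h.left_eq,
    toReal_klDiv_half_smul h.measure_univ_eq hm ht
      (h.mem_Icc.mono fun x hx => ⟨by linarith, by linarith⟩) h.right_eq,
    ← integral_withDensity_ofReal h.measurable (h.mem_Icc.mono fun x hx => ht.le.trans hx.1),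
    ← integral_withDensity_ofReal hm (h.mem_Icc.mono fun x hx => by linarith),
    ← h.left_eq, ← h.right_eq]
  ring

theorem jsDiv_le_log_two (h : IsBalancedSplit P Q σ a t) : jsDiv P Q ≤ Real.log 2 := by
  have ht := h.pos
  have h1 : ∫ x, (a x * Real.log (a x) + (1 - a x) * Real.log (1 - a x)) ∂σ ≤ 0 := by
    refine integral_nonpos_of_ae (h.mem_Icc.mono fun x hx => ?_)
    have := Real.log_nonpos (x := a x) (by linarith) (by linarith)
    have := Real.log_nonpos (x := 1 - a x) (by linarith) (by linarith)
    simp only [Pi.zero_apply]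
    nlinarith
  linarith [h.jsDiv_eq]

theorem criterion_le (h : IsBalancedSplit P Q σ a t) {D : S → ℝ} (hD : Measurable D) {κ : ℝ}
    (hκ : 0 < κ) (hDκ : ∀ x, κ ≤ D x ∧ D x ≤ 1 - κ) :
    ∫ x, Real.log (D x) ∂P + ∫ x, Real.log (1 - D x) ∂Q ≤ 2 * jsDiv P Q - 2 * Real.log 2 := by
  have ht := h.pos
  obtain ⟨h1, h2⟩ := h.integral_left_add_integral_right hD.log (hD.const_sub 1).log
    (ae_of_all _ fun x => Real.abs_log_le_of_mem_Icc hκ (hDκ x).1 (by linarith [(hDκ x).2]))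
    (ae_of_all _ fun x => Real.abs_log_le_of_mem_Icc hκ (by linarith [(hDκ x).2])
      (by linarith [(hDκ x).1]))
  rw [h2, h.jsDiv_eq]
  refine integral_mono_ae h1 h.integrable_entropy (h.mem_Icc.mono fun x hx => ?_)
  have := hDκ x
  exact mul_log_add_le_mul_log_self (by linarith) (by linarith) (by linarith) (by linarith)

/-- The loss of a discriminator at uniform distance `ε` from the optimal one is quadratic in
`ε`. -/
theorem le_criterion_add (h : IsBalancedSplit P Q σ a t) {D : S → ℝ} (hD : Measurable D) {κ : ℝ}
    (hκ : 0 < κ) (hDκ : ∀ x, κ ≤ D x ∧ D x ≤ 1 - κ) {ε : ℝ} (hε : ε ≤ t / 2)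
    (hDa : ∀ᵐ x ∂σ, |D x - a x| ≤ ε) :
    2 * jsDiv P Q - 2 * Real.log 2
      ≤ ∫ x, Real.log (D x) ∂P + ∫ x, Real.log (1 - D x) ∂Q + 8 / t ^ 2 * ε ^ 2 := by
  have ht := h.pos
  have := h.isFiniteMeasure
  obtain ⟨h1, h2⟩ := h.integral_left_add_integral_right hD.log (hD.const_sub 1).log
    (ae_of_all _ fun x => Real.abs_log_le_of_mem_Icc hκ (hDκ x).1 (by linarith [(hDκ x).2]))
    (ae_of_all _ fun x => Real.abs_log_le_of_mem_Icc hκ (by linarith [(hDκ x).2])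
      (by linarith [(hDκ x).1]))
  have h3 : 8 / t ^ 2 * ε ^ 2 = ∫ _, ε ^ 2 / (t / 2) ^ 2 ∂σ := by
    rw [integral_const, measureReal_def, h.measure_univ_eq]
    simp only [ENNReal.toReal_ofNat, smul_eq_mul]
    ring
  rw [h2, h.jsDiv_eq, h3, ← integral_add h1 (integrable_const _)]
  refine integral_mono_ae h.integrable_entropy (h1.add (integrable_const _)) ?_
  filter_upwards [h.mem_Icc, hDa] with x hx hx'
  have := abs_le.1 hx'
  exact mul_log_self_le_mul_log_add (by linarith) (by linarith) (by positivity) (by linarith)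
    (by linarith) hx'

end IsBalancedSplit

namespace GANModel

/-! ### Laws and optimal discriminators of the model -/

variable {d d' p q : ℕ} {Θ : Set (EuclideanSpace ℝ (Fin p))} (M : GANModel d d' p q Θ)

theorem isFiniteMeasure_μ : IsFiniteMeasure M.μ := by
  refine ⟨?_⟩
  rw [← Set.union_compl_self M.E]
  refine (measure_union_le _ _).trans_lt ?_
  rw [M.μ_compl, add_zero]
  exact M.μ_finite

theorem ae_mem_E : ∀ᵐ x ∂M.μ, x ∈ M.E := M.μ_compl

theorem ae_targetLaw_mem_E : ∀ᵐ x ∂M.targetLaw, x ∈ M.E :=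
  (withDensity_absolutelyContinuous M.μ _).ae_le M.ae_mem_E

theorem isProbabilityMeasure_targetLaw : IsProbabilityMeasure M.targetLaw :=
  ⟨by rw [targetLaw, withDensity_apply _ MeasurableSet.univ, Measure.restrict_univ, M.pstar_mass]⟩

theorem genLaw_eq_map {θ : EuclideanSpace ℝ (Fin p)} (hθ : θ ∈ Θ) :
    M.genLaw θ = M.ν.map (M.G θ) := (M.G_law θ hθ).symm

theorem isProbabilityMeasure_genLaw {θ : EuclideanSpace ℝ (Fin p)} (hθ : θ ∈ Θ) :
    IsProbabilityMeasure (M.genLaw θ) := by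
  have := M.ν_prob
  rw [M.genLaw_eq_map hθ]
  exact Measure.isProbabilityMeasure_map (M.G_measurable θ hθ).aemeasurable

/-- The measure `(pstar + p_θ) dμ`, that is the sum of the target law and of the generated law. -/
noncomputable def sumLaw (θ : EuclideanSpace ℝ (Fin p)) : Measure (EuclideanSpace ℝ (Fin d)) :=
  M.μ.withDensity fun x => ENNReal.ofReal (M.pstar x + M.dens θ x)

theorem measurable_pstar_add_dens {θ : EuclideanSpace ℝ (Fin p)} (hθ : θ ∈ Θ) :
    Measurable fun x => M.pstar x + M.dens θ x :=
  M.pstar_measurable.add (M.dens_measurable θ hθ)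

theorem measurable_optDisc {θ : EuclideanSpace ℝ (Fin p)} (hθ : θ ∈ Θ) :
    Measurable (M.optDisc θ) :=
  M.pstar_measurable.div (M.measurable_pstar_add_dens hθ)

theorem ae_sumLaw {θ : EuclideanSpace ℝ (Fin p)} (hθ : θ ∈ Θ) :
    ∀ᵐ x ∂M.sumLaw θ, x ∈ M.E ∧ 0 < M.pstar x + M.dens θ x := by
  rw [sumLaw, ae_withDensity_iff (M.measurable_pstar_add_dens hθ).ennreal_ofReal]
  filter_upwards [M.ae_mem_E] with x hx h
  exact ⟨hx, ENNReal.ofReal_pos.1 (pos_iff_ne_zero.2 h)⟩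

theorem isBalancedSplit {t : ℝ} (ht : 0 < t) (hM : M.LowerBounded t)
    {θ : EuclideanSpace ℝ (Fin p)} (hθ : θ ∈ Θ) :
    IsBalancedSplit M.targetLaw (M.genLaw θ) (M.sumLaw θ) (M.optDisc θ) t where
  prob_left := M.isProbabilityMeasure_targetLaw
  prob_right := M.isProbabilityMeasure_genLaw hθ
  measurable := M.measurable_optDisc hθ
  pos := ht
  mem_Icc := by
    filter_upwards [M.ae_sumLaw hθ] with x hx
    have := le_min_iff.1 (hM θ hθ x hx.1 hx.2)
    exact ⟨this.1, by linarith [this.2]⟩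
  left_eq := by
    have hm := M.measurable_pstar_add_dens hθ
    rw [sumLaw, ← withDensity_mul _ hm.ennreal_ofReal (M.measurable_optDisc hθ).ennreal_ofReal]
    refine withDensity_congr_ae ?_
    filter_upwards [M.ae_mem_E] with x hx
    have h1 := M.pstar_nonneg x hx
    have h2 := M.dens_nonneg θ hθ x hx
    rw [Pi.mul_apply, ← ENNReal.ofReal_mul (by positivity), optDisc]
    congr 1
    rcases (add_nonneg h1 h2).eq_or_lt with h0 | h0
    · rw [← h0, zero_mul]; linarith
    · field_simp
  right_eq := by
    have hm := M.measurable_pstar_add_dens hθ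
    rw [sumLaw, ← withDensity_mul _ hm.ennreal_ofReal
      ((M.measurable_optDisc hθ).const_sub 1).ennreal_ofReal]
    refine withDensity_congr_ae ?_
    filter_upwards [M.ae_mem_E] with x hx
    have h1 := M.pstar_nonneg x hx
    have h2 := M.dens_nonneg θ hθ x hx
    rw [Pi.mul_apply, ← ENNReal.ofReal_mul (by positivity), optDisc]
    congr 1
    rcases (add_nonneg h1 h2).eq_or_lt with h0 | h0
    · rw [← h0, zero_mul]; linarith
    · field_simp
      ring

theorem js_nonneg (θ : EuclideanSpace ℝ (Fin p)) : 0 ≤ M.js θ := by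
  unfold js jsDiv
  positivity

/-! ### Continuity of the Jensen-Shannon criterion -/

/-- Where `pstar` vanishes the lower bound on the optimal discriminators forces every `p_θ` to
vanish, so that the integrand of the criterion is continuous in `θ` at every point of `E`. -/
theorem continuousOn_js {t : ℝ} (ht : 0 < t) (ht1 : t ≤ 1) (hM : M.LowerBounded t) {K : ℝ}
    (hcont : ∀ x ∈ M.E, ContinuousOn (fun θ => M.dens θ x) Θ)
    (hK : ∀ x ∈ M.E, ∀ θ ∈ Θ, |M.dens θ x| ≤ K) : ContinuousOn M.js Θ := by
  have := M.isFiniteMeasure_μ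
  set I : EuclideanSpace ℝ (Fin p) → EuclideanSpace ℝ (Fin d) → ℝ := fun θ x =>
    (M.pstar x + M.dens θ x) * (M.optDisc θ x * Real.log (M.optDisc θ x)
      + (1 - M.optDisc θ x) * Real.log (1 - M.optDisc θ x)) with hI
  have hjs : ∀ θ ∈ Θ, M.js θ = Real.log 2 + 1 / 2 * ∫ x, I θ x ∂M.μ := by
    intro θ hθ
    have h := (M.isBalancedSplit ht hM hθ).jsDiv_eq
    rw [sumLaw, integral_withDensity_ofReal (M.measurable_pstar_add_dens hθ)] at h
    · rw [js]; linarith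
    · filter_upwards [M.ae_mem_E] with x hx
      exact add_nonneg (M.pstar_nonneg x hx) (M.dens_nonneg θ hθ x hx)
  refine ContinuousOn.congr ?_ hjs
  refine continuousOn_const.add (continuousOn_const.mul ?_)
  have hpi : Integrable M.pstar M.μ := by
    refine ⟨M.pstar_measurable.aestronglyMeasurable, ?_⟩
    rw [hasFiniteIntegral_iff_ofReal (M.ae_mem_E.mono M.pstar_nonneg), M.pstar_mass]
    exact ENNReal.one_lt_top
  refine continuousOn_of_dominated (bound := fun x => (M.pstar x + K) * -Real.log t) ?_ ?_ ?_ ?_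
  · intro θ hθ
    have := M.measurable_optDisc hθ
    have := M.dens_measurable θ hθ
    have := M.pstar_measurable
    exact Measurable.aestronglyMeasurable (by fun_prop)
  · intro θ hθ
    filter_upwards [M.ae_mem_E] with x hx
    have h1 := M.pstar_nonneg x hx
    have h2 := M.dens_nonneg θ hθ x hx
    have h3 := hK x hx θ hθ
    rcases (add_nonneg h1 h2).eq_or_lt with h0 | h0
    · have hp : M.pstar x = 0 := by linarith
      have hd : M.dens θ x = 0 := by linarith
      have hK0 : 0 ≤ K := (abs_nonneg _).trans h3
      have := Real.log_nonpos ht.le ht1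
      simp only [hI, hp, hd, add_zero, zero_mul, norm_zero, zero_add]
      nlinarith
    · obtain ⟨h4, h5⟩ := le_min_iff.1 (hM θ hθ x hx h0)
      set a := M.optDisc θ x with ha
      have h6 := Real.abs_log_le_of_mem_Icc ht h4 (by linarith)
      have h7 := Real.abs_log_le_of_mem_Icc ht h5 (by linarith)
      have h8 : |a * Real.log a + (1 - a) * Real.log (1 - a)| ≤ -Real.log t := by
        refine (abs_add_le _ _).trans ?_
        rw [abs_mul, abs_mul, abs_of_nonneg (ht.le.trans h4), abs_of_nonneg (ht.le.trans h5)]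
        have h9 := mul_le_mul_of_nonneg_left h6 (ht.le.trans h4)
        have h10 := mul_le_mul_of_nonneg_left h7 (ht.le.trans h5)
        linarith
      rw [Real.norm_eq_abs, abs_mul, abs_of_pos h0]
      exact mul_le_mul (by linarith [le_abs_self (M.dens θ x)]) h8 (abs_nonneg _)
        (by linarith [le_abs_self (M.dens θ x)])
  · exact (hpi.add (integrable_const _)).mul_const _
  · filter_upwards [M.ae_mem_E] with x hx
    rcases (M.pstar_nonneg x hx).eq_or_lt with h0 | h0
    · refine (continuousOn_const (c := (0 : ℝ))).congr fun θ hθ => ?_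
      have h2 := M.dens_nonneg θ hθ x hx
      have h3 : M.dens θ x = 0 := by
        by_contra hne
        have hpos : 0 < M.pstar x + M.dens θ x := by
          rw [← h0, zero_add]; exact lt_of_le_of_ne h2 (Ne.symm hne)
        have := (le_min_iff.1 (hM θ hθ x hx hpos)).1
        rw [optDisc, ← h0, zero_div] at this
        linarith
      simp [hI, ← h0, h3]
    · have hpos : ∀ θ ∈ Θ, 0 < M.pstar x + M.dens θ x := fun θ hθ =>
        add_pos_of_pos_of_nonneg h0 (M.dens_nonneg θ hθ x hx)
      have hs : ContinuousOn (fun θ => M.pstar x + M.dens θ x) Θ :=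
        continuousOn_const.add (hcont x hx)
      have ha : ContinuousOn (fun θ => M.optDisc θ x) Θ :=
        continuousOn_const.div hs fun θ hθ => (hpos θ hθ).ne'
      have hb : ContinuousOn (fun θ => 1 - M.optDisc θ x) Θ := continuousOn_const.sub ha
      refine hs.mul ((ha.mul (ha.log fun θ hθ => ?_)).add (hb.mul (hb.log fun θ hθ => ?_)))
      · exact (ht.trans_le (le_min_iff.1 (hM θ hθ x hx (hpos θ hθ))).1).ne'
      · exact (ht.trans_le (le_min_iff.1 (hM θ hθ x hx (hpos θ hθ))).2).ne'

/-! ### Regularity of the discriminators -/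

open scoped Classical in
/-- The discriminator `D α`, replaced by the constant `1 / 2` off `E`, where the model does not
constrain it. All laws of interest are carried by `E`. -/
noncomputable def discOnE (α : EuclideanSpace ℝ (Fin q)) (x : EuclideanSpace ℝ (Fin d)) : ℝ :=
  if x ∈ M.E then M.D α x else 1 / 2

theorem discOnE_of_mem (α : EuclideanSpace ℝ (Fin q)) {x : EuclideanSpace ℝ (Fin d)}
    (hx : x ∈ M.E) : M.discOnE α x = M.D α x := if_pos hx

theorem discOnE_of_notMem (α : EuclideanSpace ℝ (Fin q)) {x : EuclideanSpace ℝ (Fin d)}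
    (hx : x ∉ M.E) : M.discOnE α x = 1 / 2 := if_neg hx

variable {M} {U : Set (EuclideanSpace ℝ (Fin p))} {Λ V : Set (EuclideanSpace ℝ (Fin q))} {κ K : ℝ}

theorem Regular.discOnE_mem (hR : M.Regular U Λ V κ K) (hκ : κ < 1 / 2)
    {α : EuclideanSpace ℝ (Fin q)} (hα : α ∈ Λ) (x : EuclideanSpace ℝ (Fin d)) :
    κ ≤ M.discOnE α x ∧ M.discOnE α x ≤ 1 - κ := by
  by_cases hx : x ∈ M.E
  · rw [M.discOnE_of_mem α hx]; exact hR.1 α hα x hx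
  · rw [M.discOnE_of_notMem α hx]; constructor <;> linarith

theorem Regular.measurable_discOnE (hR : M.Regular U Λ V κ K)
    {α : EuclideanSpace ℝ (Fin q)} (hα : α ∈ V) : Measurable (M.discOnE α) := by
  classical
  obtain ⟨-, ⟨W, -, hEW, -, hC, -⟩, -⟩ := hR
  have h : ContinuousOn (fun x => M.D α x) M.E :=
    hC.continuousOn.comp (f := fun x => (x, α)) (by fun_prop) fun x hx => ⟨hEW hx, hα⟩
  exact h.measurable_piecewise (g := fun _ => (1 / 2 : ℝ)) continuousOn_const M.measurableSet_E

/-- The Lipschitz constant depends on `Λ`, `V`, `κ` and `K`, but not on the model. -/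
theorem Regular.exists_lipschitz_disc (hΛ : IsCompact Λ) (hV : IsOpen V) (hΛV : Λ ⊆ V)
    (hκ : 0 < κ) (hκ' : κ < 1 / 2) (K : ℝ) :
    ∃ A : ℝ, 0 ≤ A ∧ ∀ (d d' p : ℕ) (Θ U : Set (EuclideanSpace ℝ (Fin p)))
      (M : GANModel d d' p q Θ), M.Regular U Λ V κ K →
      ∀ α ∈ Λ, ∀ β ∈ Λ, ∀ x,
        |Real.log (M.discOnE α x) - Real.log (M.discOnE β x)| ≤ A * ‖α - β‖ := by
  obtain ⟨r, hr, hlip⟩ := hΛ.exists_lipschitz_of_fderiv_le hV hΛV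
  refine ⟨κ⁻¹ * max K r⁻¹, by positivity, fun d d' p Θ U M hR α hα β hβ x => ?_⟩
  refine (Real.abs_log_sub_log_le hκ (hR.discOnE_mem hκ' hα x).1
    (hR.discOnE_mem hκ' hβ x).1).trans ?_
  rw [mul_assoc]
  refine mul_le_mul_of_nonneg_left ?_ (by positivity)
  by_cases hx : x ∈ M.E
  · rw [M.discOnE_of_mem α hx, M.discOnE_of_mem β hx]
    obtain ⟨hval, ⟨W, hW, hEW, -, hC, hb⟩, -⟩ := hR
    have hder : ∀ γ ∈ V, ∃ L : EuclideanSpace ℝ (Fin q) →L[ℝ] ℝ, ‖L‖ ≤ K ∧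
        HasFDerivAt (fun γ => M.D γ x) L γ := by
      intro γ hγ
      have hmem : (x, γ) ∈ W ×ˢ V := ⟨hEW hx, hγ⟩
      have h1 := ((hC.differentiableOn one_ne_zero).differentiableAt
        ((hW.prod hV).mem_nhds hmem)).hasFDerivAt
      have hbd := hb _ hmem
      have hK : 0 ≤ K := (norm_nonneg _).trans hbd
      refine ⟨_, ?_, h1.comp γ (hasFDerivAt_prodMk_right x γ)⟩
      calc _ ≤ _ := ContinuousLinearMap.opNorm_comp_le _ _
        _ ≤ K * 1 := mul_le_mul hbd (ContinuousLinearMap.norm_inr_le_one ℝ _ _) (norm_nonneg _) hK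
        _ = K := mul_one K
    refine hlip (fun γ => M.D γ x) K (fun γ hγ => ?_) (fun γ hγ => ?_) ?_ α hα β hβ
    · obtain ⟨L, -, hL⟩ := hder γ hγ
      exact hL.differentiableAt
    · obtain ⟨L, hLK, hL⟩ := hder γ hγ
      rwa [hL.fderiv]
    · intro s hs s' hs'
      have h1 := hval s hs x hx
      have h2 := hval s' hs' x hx
      rw [abs_le]; constructor <;> linarith
  · rw [M.discOnE_of_notMem α hx, M.discOnE_of_notMem β hx, sub_self, abs_zero]
    positivity

/-- The bound on the derivative of `(θ, α) ↦ D α (G θ z)` comes from the chain rule; the constant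
does not depend on the model or on `z`. -/
theorem Regular.exists_lipschitz_disc_gen {Θ U : Set (EuclideanSpace ℝ (Fin p))}
    (hΘ : IsCompact Θ) (hU : IsOpen U) (hΘU : Θ ⊆ U)
    (hΛ : IsCompact Λ) (hV : IsOpen V) (hΛV : Λ ⊆ V)
    (hκ : 0 < κ) (hκ' : κ < 1 / 2) (K : ℝ) :
    ∃ A : ℝ, 0 ≤ A ∧ ∀ (d d' : ℕ) (M : GANModel d d' p q Θ), M.Regular U Λ V κ K →
      ∀ s ∈ Θ ×ˢ Λ, ∀ s' ∈ Θ ×ˢ Λ, ∀ z,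
        |Real.log (1 - M.discOnE s.2 (M.G s.1 z)) - Real.log (1 - M.discOnE s'.2 (M.G s'.1 z))|
          ≤ A * ‖s - s'‖ := by
  obtain ⟨r, hr, hlip⟩ := (hΘ.prod hΛ).exists_lipschitz_of_fderiv_le (hU.prod hV)
    (Set.prod_mono hΘU hΛV)
  refine ⟨κ⁻¹ * max (K * max K 1) r⁻¹, by positivity, fun d d' M hR s hs s' hs' z => ?_⟩
  refine (Real.abs_log_sub_log_le hκ
    (by linarith [(hR.discOnE_mem hκ' hs.2 (M.G s.1 z)).2])
    (by linarith [(hR.discOnE_mem hκ' hs'.2 (M.G s'.1 z)).2])).trans ?_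
  rw [mul_assoc]
  refine mul_le_mul_of_nonneg_left ?_ (by positivity)
  rw [M.discOnE_of_mem _ (M.G_mem _ hs.1 z), M.discOnE_of_mem _ (M.G_mem _ hs'.1 z),
    sub_sub_sub_cancel_left, abs_sub_comm]
  obtain ⟨hval, ⟨W, hW, hEW, hGW, hC, hb⟩, hG, -⟩ := hR
  have hder : ∀ y ∈ U ×ˢ V,
      ∃ L : EuclideanSpace ℝ (Fin p) × EuclideanSpace ℝ (Fin q) →L[ℝ] ℝ, ‖L‖ ≤ K * max K 1 ∧
        HasFDerivAt (fun y : EuclideanSpace ℝ (Fin p) × EuclideanSpace ℝ (Fin q) =>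
          M.D y.2 (M.G y.1 z)) L y := by
    intro y hy
    have hmem : (M.G y.1 z, y.2) ∈ W ×ˢ V := ⟨hGW _ hy.1 z, hy.2⟩
    have h1 := ((hC.differentiableOn one_ne_zero).differentiableAt
      ((hW.prod hV).mem_nhds hmem)).hasFDerivAt
    have hbd := hb _ hmem
    have hK : 0 ≤ K := (norm_nonneg _).trans hbd
    have hg := (((hG z).1.differentiableOn one_ne_zero).differentiableAt
      (hU.mem_nhds hy.1)).hasFDerivAt
    have hgb := (hG z).2.2 _ hy.1
    have h2 : HasFDerivAt (fun y : EuclideanSpace ℝ (Fin p) × EuclideanSpace ℝ (Fin q) =>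
        M.G y.1 z) ((fderiv ℝ (fun θ => M.G θ z) y.1).comp
          (ContinuousLinearMap.fst ℝ _ _)) y :=
      HasFDerivAt.comp y hg hasFDerivAt_fst
    have h3 := h2.prodMk (hasFDerivAt_snd (p := y) (𝕜 := ℝ))
    refine ⟨_, ?_, HasFDerivAt.comp
      (g := fun w : EuclideanSpace ℝ (Fin d) × EuclideanSpace ℝ (Fin q) => M.D w.2 w.1)
      (f := fun y : EuclideanSpace ℝ (Fin p) × EuclideanSpace ℝ (Fin q) =>
        (M.G y.1 z, y.2)) y h1 h3⟩
    refine (ContinuousLinearMap.opNorm_comp_le _ _).trans ?_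
    refine mul_le_mul hbd ?_ (norm_nonneg _) hK
    rw [ContinuousLinearMap.opNorm_prod, Prod.norm_def]
    refine max_le_max ?_ (ContinuousLinearMap.norm_snd_le ℝ _ _)
    calc _ ≤ _ := ContinuousLinearMap.opNorm_comp_le _ _
      _ ≤ K * 1 := mul_le_mul hgb (ContinuousLinearMap.norm_fst_le ℝ _ _) (norm_nonneg _) hK
      _ = K := mul_one K
  refine hlip (fun y => M.D y.2 (M.G y.1 z)) _ (fun γ hγ => ?_) (fun γ hγ => ?_) ?_ s hs s' hs'
  · obtain ⟨L, -, hL⟩ := hder γ hγ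
    exact hL.differentiableAt
  · obtain ⟨L, hLK, hL⟩ := hder γ hγ
    rwa [hL.fderiv]
  · intro s hs s' hs'
    have h1 := hval _ hs.2 _ (M.G_mem _ hs.1 z)
    have h2 := hval _ hs'.2 _ (M.G_mem _ hs'.1 z)
    rw [abs_le]; constructor <;> linarith

/-! ### The oracle inequality -/

/-- The deterministic part of the argument: the excess risk of an empirical minimizer is at most
the approximation error of the discriminators plus the deviations `R₁`, `R₂` of the empirical
criterion from its mean. -/
theorem js_sub_js_le (hR : M.Regular U Λ V κ K) (hκ : 0 < κ) (hκ' : κ < 1 / 2) (hΛV : Λ ⊆ V)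
    {t : ℝ} (ht : 0 < t) (hM : M.LowerBounded t) {ε : ℝ} (hε : 0 < ε)
    (happ : M.Approximates Λ ε) {θstar θhat : EuclideanSpace ℝ (Fin p)} (hstar : θstar ∈ Θ)
    {n : ℕ} (hn : 0 < n) {x : Fin n → EuclideanSpace ℝ (Fin d)}
    {z : Fin n → EuclideanSpace ℝ (Fin d')} (hx : ∀ i, x i ∈ M.E)
    (hmin : M.IsGANMinimizer Λ x z θhat) {R₁ R₂ : ℝ}
    (hR₁ : ∀ α ∈ Λ, |∑ i, Real.log (M.discOnE α (x i))
      - n * ∫ y, Real.log (M.discOnE α y) ∂M.targetLaw| ≤ R₁)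
    (hR₂ : ∀ θ ∈ Θ, ∀ α ∈ Λ, |∑ i, Real.log (1 - M.discOnE α (M.G θ (z i)))
      - n * ∫ y, Real.log (1 - M.discOnE α (M.G θ y)) ∂M.ν| ≤ R₂) :
    M.js θhat - M.js θstar ≤ 4 / t ^ 2 * ε ^ 2 + (R₁ + R₂) / n := by
  obtain ⟨hhat, hmin⟩ := hmin
  have hn' : (0 : ℝ) < n := by exact_mod_cast hn
  obtain ⟨α₀, hα₀, happ₀⟩ := happ θhat hhat
  have hR₁0 : 0 ≤ R₁ := (abs_nonneg _).trans (hR₁ α₀ hα₀)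
  have hR₂0 : 0 ≤ R₂ := (abs_nonneg _).trans (hR₂ θhat hhat α₀ hα₀)
  rcases lt_or_ge (t / 2) ε with hεt | hεt
  · -- Here the quadratic term alone exceeds the maximal value of the divergence.
    have h1 : M.js θhat ≤ Real.log 2 := (M.isBalancedSplit ht hM hhat).jsDiv_le_log_two
    have h2 : Real.log 2 ≤ 1 := by
      linarith [Real.log_le_sub_one_of_pos (x := 2) (by norm_num)]
    have h3 : 1 ≤ 4 / t ^ 2 * ε ^ 2 := by
      rw [div_mul_eq_mul_div, one_le_div (by positivity)]
      nlinarith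
    have h4 : 0 ≤ (R₁ + R₂) / n := by positivity
    linarith [M.js_nonneg θstar]
  · set c : EuclideanSpace ℝ (Fin p) → EuclideanSpace ℝ (Fin q) → ℝ := fun θ α =>
      ∫ y, Real.log (M.discOnE α y) ∂M.targetLaw
        + ∫ y, Real.log (1 - M.discOnE α y) ∂M.genLaw θ with hc
    have hdev : ∀ θ ∈ Θ, ∀ α ∈ Λ, |M.empCrit x z θ α - n * c θ α| ≤ R₁ + R₂ := by
      intro θ hθ α hα
      have hmeas := hR.measurable_discOnE (hΛV hα)
      have e1 : M.empCrit x z θ α = ∑ i, Real.log (M.discOnE α (x i))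
          + ∑ i, Real.log (1 - M.discOnE α (M.G θ (z i))) := by
        simp only [empCrit, M.discOnE_of_mem α (hx _), M.discOnE_of_mem α (M.G_mem θ hθ _)]
      have e2 : ∫ y, Real.log (1 - M.discOnE α y) ∂M.genLaw θ
          = ∫ y, Real.log (1 - M.discOnE α (M.G θ y)) ∂M.ν := by
        rw [M.genLaw_eq_map hθ, integral_map (M.G_measurable θ hθ).aemeasurable]
        exact (hmeas.const_sub 1).log.aestronglyMeasurable
      have h1 := abs_le.1 (hR₁ α hα)
      have h2 := abs_le.1 (hR₂ θ hθ α hα)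
      rw [e1, hc]
      simp only [e2]
      rw [abs_le]
      constructor <;> linarith
    have hup : ∀ θ ∈ Θ, ∀ α ∈ Λ,
        M.empCrit x z θ α ≤ n * (2 * M.js θ - 2 * Real.log 2) + (R₁ + R₂) := by
      intro θ hθ α hα
      have h1 := (M.isBalancedSplit ht hM hθ).criterion_le (hR.measurable_discOnE (hΛV hα)) hκ
        (hR.discOnE_mem hκ' hα)
      have h2 := (abs_le.1 (hdev θ hθ α hα)).2
      have h3 : n * c θ α ≤ n * (2 * M.js θ - 2 * Real.log 2) :=
        mul_le_mul_of_nonneg_left h1 hn'.le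
      linarith
    have hne : Nonempty Λ := ⟨⟨α₀, hα₀⟩⟩
    have h1 : M.empCrit x z θhat α₀ ≤ ⨆ α : Λ, M.empCrit x z θhat α :=
      le_ciSup (f := fun α : Λ => M.empCrit x z θhat α)
        ⟨_, Set.forall_mem_range.2 fun α => hup θhat hhat α α.2⟩ ⟨α₀, hα₀⟩
    have h2 : ⨆ α : Λ, M.empCrit x z θstar α
        ≤ n * (2 * M.js θstar - 2 * Real.log 2) + (R₁ + R₂) :=
      ciSup_le fun α => hup θstar hstar α α.2
    have h3 := hmin θstar hstar
    have h4 := (abs_le.1 (hdev θhat hhat α₀ hα₀)).1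
    have h5 : 2 * M.js θhat - 2 * Real.log 2 ≤ c θhat α₀ + 8 / t ^ 2 * ε ^ 2 := by
      refine (M.isBalancedSplit ht hM hhat).le_criterion_add (hR.measurable_discOnE (hΛV hα₀)) hκ
        (hR.discOnE_mem hκ' hα₀) hεt ?_
      filter_upwards [M.ae_sumLaw hhat] with y hy
      rw [M.discOnE_of_mem α₀ hy.1]
      exact happ₀ y hy.1 hy.2
    have h6 : n * c θhat α₀ ≤ n * (2 * M.js θstar - 2 * Real.log 2) + 2 * (R₁ + R₂) := by
      linarith
    have h7 : c θhat α₀ ≤ 2 * M.js θstar - 2 * Real.log 2 + 2 * ((R₁ + R₂) / n) := by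
      have h8 : n * (2 * ((R₁ + R₂) / n)) = 2 * (R₁ + R₂) := by field_simp
      refine le_of_mul_le_mul_left ?_ hn'
      linarith
    have h9 : 8 / t ^ 2 * ε ^ 2 = 2 * (4 / t ^ 2 * ε ^ 2) := by ring
    linarith

end GANModel

/-! ### The rate of convergence -/

theorem mainTheorem3 (t : ℝ) (ht : 0 < t) (ht' : t ≤ 1 / 2) :
    ∃ c₁ : ℝ, 0 < c₁ ∧
    ∀ (p q : ℕ) (Θ U : Set (EuclideanSpace ℝ (Fin p))) (Λ V : Set (EuclideanSpace ℝ (Fin q)))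
      (κ K : ℝ), IsCompact Θ → IsOpen U → Θ ⊆ U → IsCompact Λ → IsOpen V → Λ ⊆ V →
      0 < κ → κ < 1 / 2 →
    ∃ c₂ : ℝ, 0 < c₂ ∧
    ∀ (d d' : ℕ) (M : GANModel d d' p q Θ),
      M.LowerBounded t → M.Regular U Λ V κ K →
    ∀ ε : ℝ, 0 < ε → ε < t → M.Approximates Λ ε →
    ∀ θstar : EuclideanSpace ℝ (Fin p), M.IsJSMinimizer θstar →
    ∀ (n : ℕ), 0 < n →
    ∀ (Ω : Type*) [MeasurableSpace Ω] (Pr : Measure Ω) [IsProbabilityMeasure Pr]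
      (X : Fin n → Ω → EuclideanSpace ℝ (Fin d)) (Z : Fin n → Ω → EuclideanSpace ℝ (Fin d'))
      (θhat : Ω → EuclideanSpace ℝ (Fin p)),
      (∀ i, Measurable (X i)) → (∀ i, Pr.map (X i) = M.targetLaw) → iIndepFun X Pr →
      (∀ i, Measurable (Z i)) → (∀ i, Pr.map (Z i) = M.ν) → iIndepFun Z Pr →
      Measurable θhat →
      (∀ᵐ ω ∂Pr, M.IsGANMinimizer Λ (fun i => X i ω) (fun i => Z i ω) (θhat ω)) →
      Integrable (fun ω => M.js (θhat ω)) Pr ∧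
      0 ≤ (∫ ω, M.js (θhat ω) ∂Pr) - M.js θstar ∧
      (∫ ω, M.js (θhat ω) ∂Pr) - M.js θstar ≤ c₁ * ε ^ 2 + c₂ / Real.sqrt n := by
  refine ⟨4 / t ^ 2, by positivity, fun p q Θ U Λ V κ K hΘ hU hΘU hΛ hV hΛV hκ hκ' => ?_⟩
  obtain ⟨A₁, hA₁, hlip₁⟩ := GANModel.Regular.exists_lipschitz_disc hΛ hV hΛV hκ hκ' K
  obtain ⟨A₂, hA₂, hlip₂⟩ :=
    GANModel.Regular.exists_lipschitz_disc_gen hΘ hU hΘU hΛ hV hΛV hκ hκ' K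
  obtain ⟨ρ₁, hρ₁, m₁, hnet₁⟩ := hΛ.exists_hasDyadicNets
  obtain ⟨ρ₂, hρ₂, m₂, hnet₂⟩ := (hΘ.prod hΛ).exists_hasDyadicNets
  refine ⟨chainConst A₁ (-Real.log κ) ρ₁ m₁ + chainConst A₂ (-Real.log κ) ρ₂ m₂,
    add_pos (chainConst_pos hA₁ hρ₁) (chainConst_pos hA₂ hρ₂), ?_⟩
  intro d d' M hM hR ε hε hεt happ θstar hstar n hn Ω _ Pr _ X Z θhat hX hXlaw hXind hZ hZlaw
    hZind hθm hmin
  have hP := M.isProbabilityMeasure_targetLaw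
  have hν := M.ν_prob
  have hn' : (0 : ℝ) < n := by exact_mod_cast hn
  obtain ⟨R₁, hR₁i, hR₁, hR₁b⟩ := exists_envelope_of_lipschitz hn hX hXlaw hXind hρ₁ hnet₁
    (f := fun α x => Real.log (M.discOnE α x)) (A := A₁) (B := -Real.log κ)
    (fun α hα => (hR.measurable_discOnE (hΛV hα)).log) hA₁
    (fun α hα x => Real.abs_log_le_of_mem_Icc hκ (hR.discOnE_mem hκ' hα x).1
      (by linarith [(hR.discOnE_mem hκ' hα x).2]))
    (hlip₁ d d' p Θ U M hR)
  obtain ⟨R₂, hR₂i, hR₂, hR₂b⟩ := exists_envelope_of_lipschitz hn hZ hZlaw hZind hρ₂ hnet₂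
    (f := fun s z => Real.log (1 - M.discOnE s.2 (M.G s.1 z))) (A := A₂) (B := -Real.log κ)
    (fun s hs => (((hR.measurable_discOnE (hΛV hs.2)).comp
      (M.G_measurable _ hs.1)).const_sub 1).log) hA₂
    (fun s hs z => Real.abs_log_le_of_mem_Icc hκ
      (by linarith [(hR.discOnE_mem hκ' hs.2 (M.G s.1 z)).2])
      (by linarith [(hR.discOnE_mem hκ' hs.2 (M.G s.1 z)).1]))
    (hlip₂ d d' M hR)
  have hXE : ∀ᵐ ω ∂Pr, ∀ i, X i ω ∈ M.E := by
    rw [ae_all_iff]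
    intro i
    have := M.ae_targetLaw_mem_E
    rw [← hXlaw i] at this
    exact ae_of_ae_map (hX i).aemeasurable this
  have hint : Integrable (fun ω => M.js (θhat ω)) Pr := by
    have hcont : ContinuousOn M.js Θ := M.continuousOn_js ht (by linarith) hM (K := K)
      (fun x hx => ((hR.2.2.2 x hx).1.continuousOn).mono hΘU)
      (fun x hx => (hR.2.2.2 x hx).2.1)
    have hmeas : AEStronglyMeasurable (fun ω => M.js (θhat ω)) Pr := by
      classical
      have h1 : Measurable (Θ.piecewise M.js fun _ => 0) :=
        hcont.measurable_piecewise continuousOn_const hΘ.measurableSet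
      refine (h1.comp hθm).aestronglyMeasurable.congr ?_
      filter_upwards [hmin] with ω hω
      exact Set.piecewise_eq_of_mem _ _ _ hω.1
    refine Integrable.of_bound hmeas (Real.log 2) ?_
    filter_upwards [hmin] with ω hω
    rw [Real.norm_of_nonneg (M.js_nonneg _)]
    exact (M.isBalancedSplit ht hM hω.1).jsDiv_le_log_two
  refine ⟨hint, ?_, ?_⟩
  · have h1 : ∫ _, M.js θstar ∂Pr ≤ ∫ ω, M.js (θhat ω) ∂Pr :=
      integral_mono_ae (integrable_const _) hint (hmin.mono fun ω hω => hstar.2 _ hω.1)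
    simp only [integral_const, probReal_univ, one_smul] at h1
    linarith
  · have hRi : Integrable (fun ω => (R₁ ω + R₂ ω) / n) Pr := (hR₁i.add hR₂i).div_const _
    have h1 : ∫ ω, M.js (θhat ω) ∂Pr
        ≤ ∫ ω, ((M.js θstar + 4 / t ^ 2 * ε ^ 2) + (R₁ ω + R₂ ω) / n) ∂Pr := by
      refine integral_mono_ae hint ((integrable_const _).add hRi) ?_
      filter_upwards [hmin, hXE] with ω hω hωE
      have := GANModel.js_sub_js_le hR hκ hκ' hΛV ht hM hε happ hstar.1 hn hωE hω
        (fun α hα => hR₁ α hα ω) (fun θ hθ α hα => hR₂ (θ, α) ⟨hθ, hα⟩ ω)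
      linarith
    rw [integral_add (integrable_const _) hRi, integral_div, integral_add hR₁i hR₂i] at h1
    simp only [integral_const, probReal_univ, one_smul] at h1
    have h2 : (∫ ω, R₁ ω ∂Pr + ∫ ω, R₂ ω ∂Pr) / n
        ≤ (chainConst A₁ (-Real.log κ) ρ₁ m₁ + chainConst A₂ (-Real.log κ) ρ₂ m₂) / √n := by
      rw [div_le_div_iff₀ hn' (Real.sqrt_pos.2 hn')]
      have h3 : √(n : ℝ) * √n = n := Real.mul_self_sqrt hn'.le
      calc (∫ ω, R₁ ω ∂Pr + ∫ ω, R₂ ω ∂Pr) * √n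
          ≤ (√n * chainConst A₁ (-Real.log κ) ρ₁ m₁
            + √n * chainConst A₂ (-Real.log κ) ρ₂ m₂) * √n := by gcongr
        _ = (chainConst A₁ (-Real.log κ) ρ₁ m₁ + chainConst A₂ (-Real.log κ) ρ₂ m₂)
            * (√n * √n) := by ring
        _ = _ := by rw [h3]
    linarith
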